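/- Let $d,N\ge 1$ be integers. A state on $\mathbf{C}^d$ is a positive semidefinite $d\times d$ complex matrix of trace $1$; $\|\cdot\|_\infty$ denotes the operator norm on $d\times d$ complex matrices; a quantum channel is a completely positive trace-preserving linear map on $d\times d$ complex matrices. A quantum channel $R$ is called $\varepsilon$-randomizing if $$\left\| R(\phi)-\frac{\mathrm{Id}}{d}\right\|_\infty\le\frac{\varepsilon}{d}\qquad\text{for every state }\phi .$$ **Theorem.** There are absolute constants $C,c>0$ such that the following holds. Let $0<\varepsilon<1$, let $d,N\ge1$ be integers with $$N\ \ge\ \frac{C\,d}{\varepsilon^{2}}\,\max\bigl(1,\log(1/\varepsilon)\bigr),$$ and let $U_1,\dots,U_N$ be independent random matrices, each Haar-distributed on the unitary group $\mathcal{U}(d)$. Then the random map $$R(\phi)=\frac1N\sum_{i=1}^N U_i\,\phi\,U_i^\dagger$$ is an $\varepsilon$-randomizing quantum channel with nonzero probability; in fact, the probability that it is not is at most $\exp(-c\,\varepsilon^2 N)$. -/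

import Mathlib

open MeasureTheory ProbabilityTheory

noncomputable section

namespace RandomizingChannel

/-! ### Haar measure on the unitary group -/

/-- The unitary group `U(d)`, with the topology inherited from the `d × d` complex matrices. -/
abbrev UGroup (d : ℕ) : Type := Matrix.unitaryGroup (Fin d) ℂ

instance instMeasurableSpaceUGroup (d : ℕ) : MeasurableSpace (UGroup d) := borel _

instance instBorelSpaceUGroup (d : ℕ) : BorelSpace (UGroup d) := ⟨rfl⟩

instance instCompactSpaceUGroup (d : ℕ) : CompactSpace (UGroup d) := by
  refine isCompact_iff_compactSpace.mp ?_
  have hK : IsCompact (Set.univ.pi fun _ : Fin d => Set.univ.pi fun _ : Fin d =>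
      Metric.closedBall (0 : ℂ) 1) :=
    isCompact_univ_pi fun _ => isCompact_univ_pi fun _ => isCompact_closedBall _ _
  refine IsCompact.of_isClosed_subset (X := Matrix (Fin d) (Fin d) ℂ) hK isClosed_unitary ?_
  intro U hU i _ j _
  simpa using entry_norm_bound_of_unitary hU i j

/-- The Haar probability measure on `U(d)`: total mass one. -/
def haarUnitary (d : ℕ) : Measure (UGroup d) := Measure.haarMeasure ⊤

instance instIsProbabilityMeasureHaarUnitary (d : ℕ) : IsProbabilityMeasure (haarUnitary d) :=
  ⟨by simpa [haarUnitary] using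
    Measure.haarMeasure_self (K₀ := (⊤ : TopologicalSpace.PositiveCompacts (UGroup d)))⟩

/-! ### States and channels -/

open scoped ComplexOrder in
/-- A (mixed) state on `ℂ^d`: a positive semidefinite matrix of trace one. -/
def IsState {d : ℕ} (φ : Matrix (Fin d) (Fin d) ℂ) : Prop :=
  φ.PosSemidef ∧ φ.trace = 1

section Channels

open scoped Matrix.Norms.L2Operator MatrixOrder CStarAlgebra

/-- The operator norm of a matrix acting on `ℂ^d` with its Euclidean norm. -/
def opNorm {d : ℕ} (A : Matrix (Fin d) (Fin d) ℂ) : ℝ := ‖A‖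

/-- A linear map is completely positive and trace preserving. The matrices carry their C⋆-algebra
structure (operator norm) and the order in which the nonnegative elements are the positive
semidefinite matrices. -/
def IsQuantumChannel {d : ℕ}
    (R : Matrix (Fin d) (Fin d) ℂ →ₗ[ℂ] Matrix (Fin d) (Fin d) ℂ) : Prop :=
  (∃ T : Matrix (Fin d) (Fin d) ℂ →CP Matrix (Fin d) (Fin d) ℂ, T.toLinearMap = R) ∧
    ∀ A, (R A).trace = A.trace

end Channels

/-- An `ε`-randomizing quantum channel. -/
def IsRandomizing {d : ℕ} (ε : ℝ)
    (R : Matrix (Fin d) (Fin d) ℂ →ₗ[ℂ] Matrix (Fin d) (Fin d) ℂ) : Prop :=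
  IsQuantumChannel R ∧
    ∀ φ, IsState φ → opNorm (R φ - (d : ℂ)⁻¹ • (1 : Matrix (Fin d) (Fin d) ℂ)) ≤ ε / d

/-- The map `φ ↦ (1 / N) ∑ i, U i * φ * (U i)†`. -/
def unitaryMixture {d N : ℕ} (U : Fin N → UGroup d) :
    Matrix (Fin d) (Fin d) ℂ →ₗ[ℂ] Matrix (Fin d) (Fin d) ℂ where
  toFun φ := (N : ℂ)⁻¹ • ∑ i, (U i).val * φ * (U i).val.conjTranspose
  map_add' φ ψ := by
    simp only [mul_add, add_mul, Finset.sum_add_distrib, smul_add]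
  map_smul' a φ := by
    simp only [Matrix.mul_smul, Matrix.smul_mul, ← Finset.smul_sum, RingHom.id_apply]
    rw [smul_comm]

end RandomizingChannel

end

/-! For unit vectors x, y put X = d |⟨y, U x⟩|² with U Haar-distributed. Then X has mean 1 and E
exp(X/8) ≤ 2, so averages of N independent copies obey Bernstein's inequality: they deviate from 1
by more than δ ≤ 1 with probability at most 2 exp(-Nδ²/8192) (`measureReal_lt_abs_deviation_le`).
The moment bound holds because U x is invariant under unitaries: y√d may be replaced by a random
sign vector, and Rademacher sums are subgaussian.

Uniformity over x and y comes from a net of the sphere. The deviation is a Hermitian quadratic form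
in each variable, so its maximum is at most twice its maximum over a 1/8-net
(`abs_le_of_abs_le_on_net`). The mesh does not depend on ε: the union bound costs only exp(O(d)),
which is absorbed once N is a large multiple of d/ε². Mixed states reduce to pure ones by convexity
(`isRandomizing_of_abs_deviation_le`). -/

/-! ### Nets on the unit sphere. -/

/-- Volume comparison: the balls of radius δ/2 about the points are disjoint and lie in the ball of
radius ρ + δ/2 about 0. -/
theorem card_le_of_separated_of_norm_le {E : Type*} [NormedAddCommGroup E] [NormedSpace ℝ E]
    [FiniteDimensional ℝ E] {δ ρ : ℝ} (hδ : 0 < δ) (hρ : 0 ≤ ρ) (s : Finset E)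
    (hs : ∀ c ∈ s, ‖c‖ ≤ ρ) (h : ∀ c ∈ s, ∀ d ∈ s, c ≠ d → δ ≤ dist c d) :
    (s.card : ℝ) ≤ (1 + 2 * ρ / δ) ^ Module.finrank ℝ E := by
  borelize E
  let μ : Measure E := Measure.addHaar
  have hδ2 : 0 < δ / 2 := by positivity
  have hr : 0 < δ / 2 + ρ := by positivity
  have hdisj : (s : Set E).PairwiseDisjoint fun c => Metric.ball c (δ / 2) := by
    intro c hc d hd hcd
    exact Metric.ball_disjoint_ball (by linarith [h c hc d hd hcd])
  have hsub : (⋃ c ∈ s, Metric.ball c (δ / 2)) ⊆ Metric.ball (0 : E) (δ / 2 + ρ) := by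
    refine Set.iUnion₂_subset fun c hc => Metric.ball_subset_ball' ?_
    rw [dist_zero_right]
    linarith [hs c hc]
  have hvol := measure_mono (μ := μ) hsub
  rw [measure_biUnion_finset hdisj fun c _ => measurableSet_ball] at hvol
  simp only [μ.addHaar_ball_of_pos _ hδ2, μ.addHaar_ball_of_pos _ hr, Finset.sum_const,
    nsmul_eq_mul, ← mul_assoc] at hvol
  have hvol' := (ENNReal.mul_le_mul_iff_left (Metric.measure_ball_pos _ _ zero_lt_one).ne'
    measure_ball_lt_top.ne).1 hvol
  have hreal := ENNReal.toReal_le_of_le_ofReal (by positivity) hvol'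
  rw [ENNReal.toReal_mul, ENNReal.toReal_natCast, ENNReal.toReal_ofReal (by positivity),
    ← le_div_iff₀ (by positivity), ← div_pow] at hreal
  have hratio : (δ / 2 + ρ) / (δ / 2) = 1 + 2 * ρ / δ := by field_simp
  rwa [hratio] at hreal

/-- A δ-separated subset of the sphere of largest cardinality is a net, since a point far from it
could be added. The volume bound makes the largest cardinality exist. -/
theorem exists_net_sphere (E : Type*) [NormedAddCommGroup E] [NormedSpace ℝ E]
    [FiniteDimensional ℝ E] {δ : ℝ} (hδ : 0 < δ) :
    ∃ s : Finset E, (∀ x ∈ s, ‖x‖ = 1) ∧ (∀ x : E, ‖x‖ = 1 → ∃ y ∈ s, ‖x - y‖ ≤ δ) ∧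
      (s.card : ℝ) ≤ (1 + 2 / δ) ^ Module.finrank ℝ E := by
  classical
  let p : ℕ → Prop := fun k => ∃ s : Finset E, s.card = k ∧ (∀ x ∈ s, ‖x‖ = 1) ∧
    ∀ c ∈ s, ∀ d ∈ s, c ≠ d → δ ≤ dist c d
  have hbound : ∀ s : Finset E, (∀ x ∈ s, ‖x‖ = 1) →
      (∀ c ∈ s, ∀ d ∈ s, c ≠ d → δ ≤ dist c d) →
      (s.card : ℝ) ≤ (1 + 2 / δ) ^ Module.finrank ℝ E := fun s h1 h2 => by
    simpa using card_le_of_separated_of_norm_le hδ zero_le_one s (fun c hc => (h1 c hc).le) h2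
  let b := ⌊(1 + 2 / δ) ^ Module.finrank ℝ E⌋₊
  have hp0 : p 0 := ⟨∅, by simp⟩
  obtain ⟨s, hcard, h1, h2⟩ := Nat.findGreatest_spec (P := p) (Nat.zero_le b) hp0
  refine ⟨s, h1, fun x hx => ?_, hbound s h1 h2⟩
  by_contra! hfar
  have hxs : x ∉ s := fun hxs => by simpa using (hδ.trans (hfar x hxs))
  have h1' : ∀ y ∈ insert x s, ‖y‖ = 1 := by
    simpa [hx] using h1
  have h2' : ∀ c ∈ insert x s, ∀ d ∈ insert x s, c ≠ d → δ ≤ dist c d := by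
    intro c hc d hd hcd
    rcases Finset.mem_insert.1 hc with hc | hc <;> rcases Finset.mem_insert.1 hd with hd | hd
    · exact absurd (hc.trans hd.symm) hcd
    · rw [hc, dist_eq_norm]; exact (hfar d hd).le
    · rw [hd, dist_comm, dist_eq_norm]; exact (hfar c hc).le
    · exact h2 c hc d hd hcd
  have hle := Nat.le_findGreatest (P := p)
    (Nat.le_floor (hbound _ h1' h2')) ⟨_, rfl, h1', h2'⟩
  rw [Finset.card_insert_of_notMem hxs, hcard] at hle
  exact absurd hle (Nat.not_succ_le_self _)

/-! ### Hermitian forms and their values on a net. -/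

section Rayleigh

variable {E : Type*} [NormedAddCommGroup E] [InnerProductSpace ℂ E]

theorem norm_le_of_abs_re_inner_le {T : E →L[ℂ] E} (hT : T.IsSymmetric) {M : ℝ} (hM : 0 ≤ M)
    (h : ∀ x, ‖x‖ = 1 → |(inner ℂ (T x) x).re| ≤ M) : ‖T‖ ≤ M := by
  rw [T.norm_eq_iSup_rayleighQuotient hT]
  refine ciSup_le fun x => ?_
  rcases eq_or_ne x 0 with rfl | hx
  · simpa using hM
  have hn : ‖x‖ ≠ 0 := norm_ne_zero_iff.2 hx
  have hc : ((‖x‖⁻¹ : ℝ) : ℂ) ≠ 0 := by simpa using hx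
  have h1 : ‖((‖x‖⁻¹ : ℝ) : ℂ) • x‖ = 1 := by
    rw [norm_smul, Complex.norm_real, norm_inv, norm_norm, inv_mul_cancel₀ hn]
  rw [← T.rayleigh_smul x hc, ContinuousLinearMap.rayleighQuotient, h1, one_pow, div_one]
  exact h _ h1

theorem abs_re_inner_sub_le (T : E →L[ℂ] E) {x y : E} (hx : ‖x‖ = 1) (hy : ‖y‖ = 1) :
    |(inner ℂ (T x) x).re - (inner ℂ (T y) y).re| ≤ 2 * ‖T‖ * ‖x - y‖ := by
  have h : inner ℂ (T x) x - inner ℂ (T y) y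
      = inner ℂ (T (x - y)) x + inner ℂ (T y) (x - y) := by
    simp only [map_sub, inner_sub_left, inner_sub_right]; ring
  rw [← Complex.sub_re, h]
  have h1 := norm_inner_le_norm (𝕜 := ℂ) (T (x - y)) x
  have h2 := norm_inner_le_norm (𝕜 := ℂ) (T y) (x - y)
  have h3 := T.le_opNorm (x - y)
  have h4 := T.le_opNorm y
  rw [hx] at h1
  rw [hy] at h4
  have h5 := mul_le_mul_of_nonneg_right h4 (norm_nonneg (x - y))
  calc _ ≤ _ := Complex.abs_re_le_norm _
    _ ≤ _ := norm_add_le _ _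
    _ ≤ _ := by linarith

/-- A function of two vectors which is a Hermitian quadratic form in each of them is controlled on
the unit spheres by its values on a `1 / 8`-net. -/
theorem abs_le_of_abs_le_on_net [FiniteDimensional ℂ E] {f : E → E → ℝ}
    (hf : Continuous fun p : E × E => f p.1 p.2)
    (hl : ∀ y, ∃ T : E →L[ℂ] E, T.IsSymmetric ∧ ∀ x, f x y = (inner ℂ (T x) x).re)
    (hr : ∀ x, ∃ T : E →L[ℂ] E, T.IsSymmetric ∧ ∀ y, f x y = (inner ℂ (T y) y).re)
    {s : Finset E} (hs : ∀ x ∈ s, ‖x‖ = 1) (hnet : ∀ x : E, ‖x‖ = 1 → ∃ y ∈ s, ‖x - y‖ ≤ 1 / 8)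
    {M : ℝ} (hM : ∀ x ∈ s, ∀ y ∈ s, |f x y| ≤ M) {x y : E} (hx : ‖x‖ = 1) (hy : ‖y‖ = 1) :
    |f x y| ≤ 2 * M := by
  have := FiniteDimensional.proper ℂ E
  have hcpt := (isCompact_sphere (0 : E) 1).prod (isCompact_sphere (0 : E) 1)
  -- Compactness supplies a maximizer (a, b); it bounds the norms of the operators of both forms
  -- below.
  obtain ⟨⟨a, b⟩, ⟨ha, hb⟩, hmax⟩ := hcpt.exists_isMaxOn ⟨(x, y), by simp [hx, hy]⟩
    hf.abs.continuousOn
  simp only [mem_sphere_zero_iff_norm] at ha hb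
  have hmax' : ∀ u v : E, ‖u‖ = 1 → ‖v‖ = 1 → |f u v| ≤ |f a b| := fun u v hu hv =>
    hmax (show (u, v) ∈ _ by simp [hu, hv])
  obtain ⟨a₀, ha₀, haa⟩ := hnet a ha
  obtain ⟨b₀, hb₀, hbb⟩ := hnet b hb
  obtain ⟨T, hT, hTf⟩ := hl b
  obtain ⟨S, hS, hSf⟩ := hr a₀
  have hTn := norm_le_of_abs_re_inner_le hT (abs_nonneg (f a b)) fun u hu => by
    rw [← hTf]; exact hmax' u b hu hb
  have hSn := norm_le_of_abs_re_inner_le hS (abs_nonneg (f a b)) fun u hu => by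
    rw [← hSf]; exact hmax' a₀ u (hs _ ha₀) hu
  have h1 := abs_re_inner_sub_le T ha (hs _ ha₀)
  have h2 := abs_re_inner_sub_le S hb (hs _ hb₀)
  rw [← hTf, ← hTf] at h1
  rw [← hSf, ← hSf] at h2
  -- Moving a, then b, to the net costs 2 · |f a b| · 1/8 each, so |f a b| ≤ M + |f a b| / 2.
  have h3 := mul_le_mul hTn haa (norm_nonneg _) (abs_nonneg _)
  have h4 := mul_le_mul hSn hbb (norm_nonneg _) (abs_nonneg _)
  have h5 := hM a₀ ha₀ b₀ hb₀
  have h6 := abs_sub_le (f a b) (f a₀ b) 0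
  have h7 := abs_sub_le (f a₀ b) (f a₀ b₀) 0
  simp only [sub_zero] at h6 h7
  linarith [hmax' x y hx hy]

end Rayleigh

/-! ### Reduction of the randomizing property to pairs of unit vectors. -/

namespace RandomizingChannel

open scoped Matrix.Norms.L2Operator MatrixOrder CStarAlgebra ComplexOrder

/-- Conjugation by a unitary is a ⋆-automorphism, hence completely positive, and positive
combinations preserve this. -/
theorem unitaryMixture_isQuantumChannel {d N : ℕ} (hN : 0 < N) (U : Fin N → UGroup d) :
    IsQuantumChannel (unitaryMixture U) := by
  refine ⟨⟨⟨unitaryMixture U, fun k M hM => ?_⟩, rfl⟩, fun A => ?_⟩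
  · have hmap : M.map (unitaryMixture U)
        = ((N : ℝ)⁻¹ : ℝ) • ∑ i, M.map (Unitary.conjStarAlgAut ℂ _ (U i)) := by
      ext1 i j
      have hsum : ∀ s : Finset (Fin N), (∑ i ∈ s, M.map (Unitary.conjStarAlgAut ℂ _ (U i))) i j
          = ∑ l ∈ s, Unitary.conjStarAlgAut ℂ _ (U l) (M i j) := fun s => by
        classical
        induction s using Finset.induction_on with
        | empty => rfl
        | insert l s hl ih => simp [Finset.sum_insert hl, ih]
      rw [CStarMatrix.map_apply, CStarMatrix.smul_apply, hsum]
      simp only [unitaryMixture, LinearMap.coe_mk, AddHom.coe_mk, Unitary.conjStarAlgAut_apply,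
        Matrix.star_eq_conjTranspose]
      rw [← Complex.coe_smul]
      simp
    change 0 ≤ M.map (unitaryMixture U)
    rw [hmap]
    refine smul_nonneg (by positivity) (Finset.sum_nonneg fun i _ => ?_)
    exact CompletelyPositiveMapClass.map_cstarMatrix_nonneg'
      (Unitary.conjStarAlgAut ℂ (Matrix (Fin d) (Fin d) ℂ) (U i)) k M hM
  · have h : ∀ i, ((U i).val * A * (U i).val.conjTranspose).trace = A.trace := fun i => by
      rw [Matrix.trace_mul_comm, ← mul_assoc, ← Matrix.star_eq_conjTranspose,
        Unitary.coe_star_mul_self, one_mul]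
    have hN' : (N : ℂ) ≠ 0 := by exact_mod_cast hN.ne'
    simp [unitaryMixture, Matrix.trace_smul, Matrix.trace_sum, h, hN']

/-- The action of a unitary matrix on the Euclidean space `ℂ^d`. -/
noncomputable abbrev toOp {d : ℕ} (U : UGroup d) :
    EuclideanSpace ℂ (Fin d) →L[ℂ] EuclideanSpace ℂ (Fin d) :=
  Matrix.toEuclideanCLM (n := Fin d) (𝕜 := ℂ) U.val

theorem toOp_mul {d : ℕ} (U V : UGroup d) (x : EuclideanSpace ℂ (Fin d)) :
    toOp (U * V) x = toOp U (toOp V x) := by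
  simp [toOp]

theorem inner_toOp_left {d : ℕ} (U : UGroup d) (x y : EuclideanSpace ℂ (Fin d)) :
    inner ℂ (toOp U x) y = inner ℂ x (toOp (star U) y) := by
  have : toOp (star U) = ContinuousLinearMap.adjoint (toOp U) := by
    simp [toOp, ← ContinuousLinearMap.star_eq_adjoint, map_star]
  rw [this, ContinuousLinearMap.adjoint_inner_right]

theorem toOp_star_toOp {d : ℕ} (U : UGroup d) (x : EuclideanSpace ℂ (Fin d)) :
    toOp (star U) (toOp U x) = x := by
  rw [← toOp_mul, Unitary.star_mul_self]
  simp [toOp]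

theorem inner_toOp_toOp {d : ℕ} (U : UGroup d) (x y : EuclideanSpace ℂ (Fin d)) :
    inner ℂ (toOp U x) (toOp U y) = inner ℂ x y := by
  rw [inner_toOp_left, toOp_star_toOp]

theorem norm_toOp {d : ℕ} (U : UGroup d) (x : EuclideanSpace ℂ (Fin d)) :
    ‖toOp U x‖ = ‖x‖ := by
  rw [@norm_eq_sqrt_re_inner ℂ, inner_toOp_toOp, ← norm_eq_sqrt_re_inner]

/-- The deviation `⟨y, R(|x⟩⟨x|) y⟩ - ‖x‖² ‖y‖² / d` of the mixture `R` from the completely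
randomizing channel. -/
noncomputable def deviation {d N : ℕ} (U : Fin N → UGroup d) (x y : EuclideanSpace ℂ (Fin d)) : ℝ :=
  (N : ℝ)⁻¹ * ∑ i, ‖inner ℂ y (toOp (U i) x)‖ ^ 2 - ‖x‖ ^ 2 * ‖y‖ ^ 2 / d

/-- This symmetry transfers what is known in the variable y to the variable x. -/
theorem deviation_star {d N : ℕ} (U : Fin N → UGroup d) (x y : EuclideanSpace ℂ (Fin d)) :
    deviation (fun i => star (U i)) x y = deviation U y x := by
  have h : ∀ i, ‖inner ℂ y (toOp (star (U i)) x)‖ = ‖inner ℂ x (toOp (U i) y)‖ := fun i => by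
    rw [← inner_toOp_left, norm_inner_symm]
  simp only [deviation, h, mul_comm]

theorem continuous_deviation {d N : ℕ} (U : Fin N → UGroup d) :
    Continuous fun p : EuclideanSpace ℂ (Fin d) × EuclideanSpace ℂ (Fin d) =>
      deviation U p.1 p.2 := by
  unfold deviation
  fun_prop

theorem exists_isSymmetric_deviation {d N : ℕ} (U : Fin N → UGroup d)
    (x : EuclideanSpace ℂ (Fin d)) :
    ∃ T : EuclideanSpace ℂ (Fin d) →L[ℂ] EuclideanSpace ℂ (Fin d),
      T.IsSymmetric ∧ ∀ y, deviation U x y = (inner ℂ (T y) y).re := by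
  -- This is R(|x⟩⟨x|) - (‖x‖²/d) Id.
  let T : EuclideanSpace ℂ (Fin d) →L[ℂ] EuclideanSpace ℂ (Fin d) :=
    ((N : ℝ)⁻¹ : ℂ) • ∑ i, InnerProductSpace.rankOne ℂ (toOp (U i) x) (toOp (U i) x)
      - ((‖x‖ ^ 2 / d : ℝ) : ℂ) • ContinuousLinearMap.id ℂ _
  refine ⟨T, fun y z => ?_, fun y => ?_⟩
  · simp [T, inner_sub_left, inner_sub_right, inner_smul_left, inner_smul_right, sum_inner,
      inner_sum, mul_comm]
  · have h : inner ℂ (T y) y = (deviation U x y : ℂ) := by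
      simp only [T, sub_apply, smul_apply, sum_apply, InnerProductSpace.rankOne_apply,
        ContinuousLinearMap.id_apply, inner_sub_left, inner_smul_left, sum_inner, deviation,
        inner_self_eq_norm_sq_to_K, inner_conj_symm]
      have h2 : ∀ i, inner ℂ y (toOp (U i) x) * inner ℂ (toOp (U i) x) y
          = ((‖inner ℂ y (toOp (U i) x)‖ ^ 2 : ℝ) : ℂ) := fun i => by
        rw [← inner_conj_symm (toOp (U i) x) y, Complex.mul_conj, Complex.normSq_eq_norm_sq]
      simp only [h2]
      simp
      ring
    rw [h, Complex.ofReal_re]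

theorem exists_isSymmetric_deviation_left {d N : ℕ} (U : Fin N → UGroup d)
    (y : EuclideanSpace ℂ (Fin d)) :
    ∃ T : EuclideanSpace ℂ (Fin d) →L[ℂ] EuclideanSpace ℂ (Fin d),
      T.IsSymmetric ∧ ∀ x, deviation U x y = (inner ℂ (T x) x).re := by
  simpa only [deviation_star] using exists_isSymmetric_deviation (fun i => star (U i)) y

theorem deviation_smul_smul {d N : ℕ} (U : Fin N → UGroup d) (a b : ℂ)
    (x y : EuclideanSpace ℂ (Fin d)) :
    deviation U (a • x) (b • y) = ‖a‖ ^ 2 * ‖b‖ ^ 2 * deviation U x y := by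
  simp only [deviation, map_smul, inner_smul_left, inner_smul_right, norm_mul, norm_smul, mul_pow,
    RCLike.norm_conj, ← Finset.mul_sum]
  ring

theorem abs_deviation_le {d N : ℕ} {U : Fin N → UGroup d} {η : ℝ}
    (h : ∀ x y : EuclideanSpace ℂ (Fin d), ‖x‖ = 1 → ‖y‖ = 1 → |deviation U x y| ≤ η)
    (x : EuclideanSpace ℂ (Fin d)) {y : EuclideanSpace ℂ (Fin d)} (hy : ‖y‖ = 1) :
    |deviation U x y| ≤ η * ‖x‖ ^ 2 := by
  rcases eq_or_ne x 0 with rfl | hx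
  · simp [deviation]
  have hn : ‖x‖ ≠ 0 := norm_ne_zero_iff.2 hx
  have h1 := h ((‖x‖⁻¹ : ℝ) • x) y (by simp [norm_smul, hn]) hy
  have h2 := deviation_smul_smul U ‖x‖ 1 (((‖x‖⁻¹ : ℝ) : ℂ) • x) y
  rw [smul_smul, one_smul, ← Complex.ofReal_mul, mul_inv_cancel₀ hn, Complex.ofReal_one, one_smul]
    at h2
  rw [h2]
  simp only [Complex.norm_real, norm_norm, norm_one, one_pow, mul_one, abs_mul, abs_pow, abs_norm]
  rw [mul_comm]
  exact mul_le_mul_of_nonneg_right h1 (by positivity)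

/-- A factorization φ = B⋆B writes φ as the sum of |x_k⟩⟨x_k| over the conjugated rows x_k of B,
without diagonalizing φ. -/
theorem inner_unitaryMixture_conjTranspose_mul_self {d N : ℕ} (U : Fin N → UGroup d)
    (B : Matrix (Fin d) (Fin d) ℂ) (y : EuclideanSpace ℂ (Fin d)) :
    inner ℂ (Matrix.toEuclideanCLM (n := Fin d) (𝕜 := ℂ) (unitaryMixture U (star B * B)) y) y
      = (((N : ℝ)⁻¹ * ∑ i, ∑ k, ‖inner ℂ y (toOp (U i) (WithLp.toLp 2 fun j => star (B k j)))‖ ^ 2 : ℝ) : ℂ) := by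
  have hB : ∀ z : EuclideanSpace ℂ (Fin d),
      ‖Matrix.toEuclideanCLM (n := Fin d) (𝕜 := ℂ) B z‖ ^ 2
        = ∑ k, ‖inner ℂ (WithLp.toLp 2 fun j => star (B k j) : EuclideanSpace ℂ (Fin d)) z‖ ^ 2 := fun z => by
    rw [EuclideanSpace.norm_sq_eq]
    refine Finset.sum_congr rfl fun k _ => ?_
    rw [Matrix.ofLp_toEuclideanCLM, EuclideanSpace.inner_eq_star_dotProduct]
    simp [Matrix.mulVec, dotProduct]
    simp [mul_comm]
  have h : ∀ i, inner ℂ (Matrix.toEuclideanCLM (n := Fin d) (𝕜 := ℂ)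
      ((U i).val * (star B * B) * (U i).val.conjTranspose) y) y
        = ((∑ k, ‖inner ℂ y (toOp (U i) (WithLp.toLp 2 fun j => star (B k j)))‖ ^ 2 : ℝ) : ℂ) := fun i => by
    have hstar : Matrix.toEuclideanCLM (n := Fin d) (𝕜 := ℂ) (star B)
        = ContinuousLinearMap.adjoint (Matrix.toEuclideanCLM (n := Fin d) (𝕜 := ℂ) B) := by
      rw [map_star, ContinuousLinearMap.star_eq_adjoint]
    simp only [map_mul, mul_apply_eq_comp, hstar]
    rw [inner_toOp_left, ContinuousLinearMap.adjoint_inner_left, ← Matrix.star_eq_conjTranspose]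
    rw [← Unitary.coe_star, inner_self_eq_norm_sq_to_K]
    simp only [norm_inner_symm y, inner_toOp_left]
    rw [← hB]
    push_cast
    rfl
  simp only [unitaryMixture, LinearMap.coe_mk, AddHom.coe_mk, map_smul, map_sum, smul_apply,
    sum_apply, inner_smul_left, sum_inner, h]
  simp

/-- The squared norms of the x_k add up to tr φ = 1, so the deviation of φ is bounded by a convex
combination of pure-state deviations. -/
theorem isRandomizing_of_abs_deviation_le {d N : ℕ} (hN : 0 < N) {U : Fin N → UGroup d} {ε : ℝ}
    (hε : 0 ≤ ε)
    (h : ∀ x y : EuclideanSpace ℂ (Fin d), ‖x‖ = 1 → ‖y‖ = 1 → |deviation U x y| ≤ ε / d) :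
    IsRandomizing ε (unitaryMixture U) := by
  refine ⟨unitaryMixture_isQuantumChannel hN U, fun φ hφ => ?_⟩
  obtain ⟨hpos, htr⟩ := hφ
  obtain ⟨B, rfl⟩ := CStarAlgebra.nonneg_iff_eq_star_mul_self.1 hpos.nonneg
  have hsum : ∑ k, ‖(WithLp.toLp 2 fun j => star (B k j) : EuclideanSpace ℂ (Fin d))‖ ^ 2 = 1 := by
    have htr' : ((∑ k, ‖(WithLp.toLp 2 fun j => star (B k j) : EuclideanSpace ℂ (Fin d))‖ ^ 2 : ℝ) : ℂ)
        = 1 := by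
      rw [← htr, Matrix.trace_mul_comm]
      simp only [EuclideanSpace.norm_sq_eq, Matrix.trace, Matrix.diag, Matrix.mul_apply,
        Matrix.star_apply, norm_star, Complex.ofReal_sum]
      simp [Complex.mul_conj, Complex.normSq_eq_norm_sq]
    exact_mod_cast htr'
  rw [opNorm, ← Matrix.l2_opNorm_toEuclideanCLM]
  refine norm_le_of_abs_re_inner_le ?_ (by positivity) fun y hy => ?_
  · have hherm : (unitaryMixture U (star B * B) - (d : ℂ)⁻¹ • 1).IsHermitian := by
      refine Matrix.IsHermitian.sub ?_ ?_
      · simp [unitaryMixture, Matrix.IsHermitian, Matrix.conjTranspose_sum,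
          Matrix.star_eq_conjTranspose, mul_assoc]
      · simp [Matrix.IsHermitian]
    exact Matrix.isSymmetric_toEuclideanLin_iff.2 hherm
  · have key : (inner ℂ (Matrix.toEuclideanCLM (n := Fin d) (𝕜 := ℂ)
        (unitaryMixture U (star B * B) - (d : ℂ)⁻¹ • 1) y) y).re
        = ∑ k, deviation U (WithLp.toLp 2 fun j => star (B k j)) y := by
      rw [map_sub, sub_apply, inner_sub_left,
        inner_unitaryMixture_conjTranspose_mul_self]
      simp only [deviation, Finset.sum_sub_distrib, ← Finset.sum_div, ← Finset.sum_mul, hsum,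
        ← Finset.mul_sum]
      rw [Finset.sum_comm, Complex.sub_re, Complex.ofReal_re]
      simp [hy, inner_smul_left]
    rw [key]
    calc _ ≤ ∑ k, |deviation U (WithLp.toLp 2 fun j => star (B k j)) y| := Finset.abs_sum_le_sum_abs _ _
      _ ≤ ∑ k, ε / d * ‖(WithLp.toLp 2 fun j => star (B k j) : EuclideanSpace ℂ (Fin d))‖ ^ 2 :=
        Finset.sum_le_sum fun k _ => abs_deviation_le h _ hy
      _ = ε / d := by rw [← Finset.mul_sum, hsum, mul_one]

end RandomizingChannel

/-! ### Exponential square moments of sign sums. -/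

theorem integrable_exp_mul_sub_sq (s : ℝ) : Integrable fun x : ℝ => Real.exp (s * x - x ^ 2) := by
  have h := ((integrable_exp_neg_mul_sq one_pos).comp_sub_right (s / 2)).const_mul
    (Real.exp (s ^ 2 / 4))
  refine h.congr (ae_of_all _ fun x => ?_)
  simp only [← Real.exp_add]
  ring_nf

theorem integral_exp_mul_sub_sq (s : ℝ) :
    ∫ x : ℝ, Real.exp (s * x - x ^ 2) = √Real.pi * Real.exp (s ^ 2 / 4) := by
  have h : ∀ x : ℝ, Real.exp (s * x - x ^ 2)
      = Real.exp (-1 * (x - s / 2) ^ 2) * Real.exp (s ^ 2 / 4) := fun x => by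
    rw [← Real.exp_add]
    ring_nf
  simp_rw [h]
  rw [integral_mul_const, integral_sub_right_eq_self (fun x : ℝ => Real.exp (-1 * x ^ 2)),
    integral_gaussian, div_one]

section Signs

variable {ι : Type*} [Fintype ι]

/-- The sign attached to a Boolean. -/
def boolSign (b : Bool) : ℝ := if b then 1 else -1

theorem sum_exp_signs_le [DecidableEq ι] (a : ι → ℝ) (t : ℝ) (ha : ∑ j, a j ^ 2 ≤ 1) :
    ∑ g : ι → Bool, Real.exp ((∑ j, boolSign (g j) * a j) * t)
      ≤ 2 ^ Fintype.card ι * Real.exp (t ^ 2 / 2) := by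
  have h1 : ∑ g : ι → Bool, Real.exp ((∑ j, boolSign (g j) * a j) * t)
      = ∏ j, (2 * Real.cosh (a j * t)) := by
    have h := Finset.prod_univ_sum (fun _ : ι => (Finset.univ : Finset Bool))
      fun j b => Real.exp (boolSign b * a j * t)
    rw [Fintype.piFinset_univ] at h
    simp_rw [Finset.sum_mul, Real.exp_sum]
    rw [← h]
    refine Finset.prod_congr rfl fun j _ => ?_
    rw [Fintype.sum_bool, Real.cosh_eq]
    simp [boolSign]
    ring
  rw [h1, Finset.prod_mul_distrib, Finset.prod_const, Finset.card_univ]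
  refine mul_le_mul_of_nonneg_left ?_ (by positivity)
  calc ∏ j, Real.cosh (a j * t) ≤ ∏ j, Real.exp ((a j * t) ^ 2 / 2) :=
        Finset.prod_le_prod (fun j _ => (Real.cosh_pos _).le)
          fun j _ => Real.cosh_le_exp_half_sq _
    _ = Real.exp ((∑ j, a j ^ 2) * (t ^ 2 / 2)) := by
        rw [← Real.exp_sum, Finset.sum_mul]
        congr 1
        exact Finset.sum_congr rfl fun j _ => by ring
    _ ≤ Real.exp (t ^ 2 / 2) :=
        Real.exp_le_exp.2 (mul_le_of_le_one_left (by positivity) ha)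

/-- Gaussian linearization: exp(S²/4) is the integral of exp(Sx - x²)/√π over x. The subgaussian
bound under the integral leaves exp(-x²/2), whose integral is √(2π). -/
theorem sum_exp_sq_signs_le [DecidableEq ι] (a : ι → ℝ) (ha : ∑ j, a j ^ 2 ≤ 1) :
    ∑ g : ι → Bool, Real.exp ((∑ j, boolSign (g j) * a j) ^ 2 / 4)
      ≤ 2 ^ Fintype.card ι * √2 := by
  have hpi : 0 < √Real.pi := Real.sqrt_pos.2 Real.pi_pos
  refine le_of_mul_le_mul_left ?_ hpi
  calc √Real.pi * ∑ g : ι → Bool, Real.exp ((∑ j, boolSign (g j) * a j) ^ 2 / 4)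
      = ∫ x : ℝ, ∑ g : ι → Bool, Real.exp ((∑ j, boolSign (g j) * a j) * x - x ^ 2) := by
        rw [integral_finsetSum _ fun g _ => integrable_exp_mul_sub_sq _, Finset.mul_sum]
        simp_rw [integral_exp_mul_sub_sq]
    _ ≤ ∫ x : ℝ, 2 ^ Fintype.card ι * Real.exp (-(1 / 2) * x ^ 2) := by
        refine integral_mono (integrable_finsetSum _ fun g _ => integrable_exp_mul_sub_sq _)
          ((integrable_exp_neg_mul_sq (by norm_num)).const_mul _) fun x => ?_
        simp only [Real.exp_sub, ← Finset.sum_div]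
        rw [div_le_iff₀ (Real.exp_pos _), mul_assoc, ← Real.exp_add]
        refine (sum_exp_signs_le a x ha).trans (le_of_eq ?_)
        ring_nf
    _ = √Real.pi * (2 ^ Fintype.card ι * √2) := by
        rw [integral_const_mul, integral_gaussian, mul_left_comm, ← Real.sqrt_mul Real.pi_pos.le]
        congr 2
        ring

/-- The real and imaginary parts are separated by AM-GM, which halves the exponent from 1/4 to 1/8.
-/
theorem sum_exp_norm_sq_signs_le [DecidableEq ι] (v : ι → ℂ) (hv : ∑ j, ‖v j‖ ^ 2 ≤ 1) :
    ∑ g : ι → Bool, Real.exp (‖∑ j, (boolSign (g j) : ℂ) * v j‖ ^ 2 / 8)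
      ≤ 2 ^ Fintype.card ι * √2 := by
  have hnorm : ∀ z : ℂ, ‖z‖ ^ 2 = z.re ^ 2 + z.im ^ 2 := fun z => by
    rw [Complex.sq_norm, Complex.normSq_apply]; ring
  have hre : ∑ j, (v j).re ^ 2 ≤ 1 := (Finset.sum_le_sum fun j _ => by
    rw [hnorm]; nlinarith [sq_nonneg (v j).im]).trans hv
  have him : ∑ j, (v j).im ^ 2 ≤ 1 := (Finset.sum_le_sum fun j _ => by
    rw [hnorm]; nlinarith [sq_nonneg (v j).re]).trans hv
  have h1 := sum_exp_sq_signs_le _ hre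
  have h2 := sum_exp_sq_signs_le _ him
  have h3 : ∀ g : ι → Bool, Real.exp (‖∑ j, (boolSign (g j) : ℂ) * v j‖ ^ 2 / 8)
      ≤ (Real.exp ((∑ j, boolSign (g j) * (v j).re) ^ 2 / 4)
        + Real.exp ((∑ j, boolSign (g j) * (v j).im) ^ 2 / 4)) / 2 := fun g => by
    rw [hnorm]
    simp only [Complex.re_sum, Complex.im_sum, Complex.re_ofReal_mul, Complex.im_ofReal_mul]
    set p := (∑ j, boolSign (g j) * (v j).re) ^ 2
    set q := (∑ j, boolSign (g j) * (v j).im) ^ 2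
    have hp : Real.exp (p / 4) = Real.exp (p / 8) ^ 2 := by
      rw [← Real.exp_nat_mul]; congr 1; push_cast; ring
    have hq : Real.exp (q / 4) = Real.exp (q / 8) ^ 2 := by
      rw [← Real.exp_nat_mul]; congr 1; push_cast; ring
    rw [hp, hq, add_div, Real.exp_add]
    nlinarith [sq_nonneg (Real.exp (p / 8) - Real.exp (q / 8))]
  refine (Finset.sum_le_sum fun g _ => h3 g).trans ?_
  rw [← Finset.sum_div, Finset.sum_add_distrib]
  linarith

end Signs

/-! ### A Bernstein inequality from one exponential moment. -/

theorem exp_le_one_add_add_sq_mul_exp_abs (z : ℝ) :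
    Real.exp z ≤ 1 + z + z ^ 2 * Real.exp |z| := by
  rcases le_or_gt |z| 1 with h | h
  · have h1 := (abs_le.1 (Real.abs_exp_sub_one_sub_id_le h)).2
    have h2 := le_mul_of_one_le_right (sq_nonneg z) (Real.one_le_exp (abs_nonneg z))
    linarith
  · rcases le_abs.1 h.le with h' | h'
    · rw [abs_of_nonneg (by linarith)]
      nlinarith [Real.exp_pos z, mul_le_mul_of_nonneg_right (one_le_pow₀ h' : 1 ≤ z ^ 2)
        (Real.exp_pos z).le]
    · have h1 : Real.exp z ≤ 1 := Real.exp_le_one_iff.2 (by linarith)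
      have h2 := le_mul_of_one_le_right (sq_nonneg z) (Real.one_le_exp (abs_nonneg z))
      nlinarith

theorem exp_mul_sub_one_le {x t : ℝ} (hx : 0 ≤ x) (ht : |t| ≤ 1 / 16) :
    Real.exp (t * (x - 1)) ≤ 1 + t * (x - 1) + 1024 * t ^ 2 * Real.exp (x / 8) := by
  have hu : |x - 1| ≤ x + 1 := abs_le.2 ⟨by linarith, by linarith⟩
  have h1 := exp_le_one_add_add_sq_mul_exp_abs (t * (x - 1))
  have h2 : Real.exp |t * (x - 1)| ≤ Real.exp ((x + 1) / 16) := by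
    rw [abs_mul, Real.exp_le_exp]
    nlinarith [abs_nonneg t, abs_nonneg (x - 1)]
  -- With u = (x + 1)/16, (x - 1)² ≤ 256 u² ≤ 512 exp u. One factor exp u pays for the square,
  -- another for the remainder, and exp(2u) is exp(x/8) up to exp(1/8) ≤ 2.
  have h3 : (x - 1) ^ 2 ≤ 512 * Real.exp ((x + 1) / 16) := by
    have := Real.quadratic_le_exp_of_nonneg (show 0 ≤ (x + 1) / 16 by positivity)
    nlinarith
  have h4 : Real.exp ((x + 1) / 16) * Real.exp ((x + 1) / 16) ≤ 2 * Real.exp (x / 8) := by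
    rw [← Real.exp_add, show (x + 1) / 16 + (x + 1) / 16 = 1 / 8 + x / 8 by ring, Real.exp_add]
    refine mul_le_mul_of_nonneg_right ?_ (Real.exp_pos _).le
    have := (abs_le.1 (Real.abs_exp_sub_one_sub_id_le (x := 1 / 8) (by norm_num [abs_of_pos]))).2
    linarith
  have h5 : (t * (x - 1)) ^ 2 * Real.exp |t * (x - 1)| ≤ 1024 * t ^ 2 * Real.exp (x / 8) := by
    calc (t * (x - 1)) ^ 2 * Real.exp |t * (x - 1)|
        = t ^ 2 * ((x - 1) ^ 2 * Real.exp |t * (x - 1)|) := by ring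
      _ ≤ t ^ 2 * (512 * Real.exp ((x + 1) / 16) * Real.exp ((x + 1) / 16)) := by gcongr
      _ ≤ t ^ 2 * (512 * (2 * Real.exp (x / 8))) := by
        rw [mul_assoc 512]; gcongr
      _ = _ := by ring
  linarith

section Chernoff

variable {Ω : Type*} [MeasurableSpace Ω] {μ : Measure Ω} [IsProbabilityMeasure μ]

/-- The linear term integrates to 0 because the mean is 1, leaving 1024 · 2 · t². -/
theorem mgf_sub_one_le {X : Ω → ℝ} (h0 : ∀ ω, 0 ≤ X ω) (hX : Integrable X μ)
    (hXe : Integrable (fun ω => Real.exp (X ω / 8)) μ) (hmean : ∫ ω, X ω ∂μ = 1)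
    (hexp : ∫ ω, Real.exp (X ω / 8) ∂μ ≤ 2) {t : ℝ} (ht : |t| ≤ 1 / 16) :
    mgf (fun ω => X ω - 1) μ t ≤ Real.exp (2048 * t ^ 2) := by
  have hlin : Integrable (fun ω => 1 + t * (X ω - 1)) μ := by fun_prop
  calc mgf (fun ω => X ω - 1) μ t
      ≤ ∫ ω, (1 + t * (X ω - 1) + 1024 * t ^ 2 * Real.exp (X ω / 8)) ∂μ :=
        integral_mono_of_nonneg (ae_of_all _ fun ω => (Real.exp_pos _).le)
          (hlin.add (hXe.const_mul _)) (ae_of_all _ fun ω => exp_mul_sub_one_le (h0 ω) ht)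
    _ = 1 + 1024 * t ^ 2 * ∫ ω, Real.exp (X ω / 8) ∂μ := by
        rw [integral_add hlin (hXe.const_mul _), integral_const_mul,
          integral_add (by fun_prop) (by fun_prop), integral_const_mul,
          integral_sub hX (by fun_prop), hmean]
        simp
    _ ≤ 2048 * t ^ 2 + 1 := by nlinarith [sq_nonneg t]
    _ ≤ Real.exp (2048 * t ^ 2) := Real.add_one_le_exp _

/-- Chernoff's method at t = ±δ/(2K), which optimizes Kt² - tδ. The bound B serves integrability
only and does not enter the estimate. -/
theorem measureReal_le_abs_sum_le {N : ℕ} {Y : Fin N → Ω → ℝ} (hind : iIndepFun Y μ)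
    (hm : ∀ i, AEMeasurable (Y i) μ) {B : ℝ} (hB : ∀ i ω, |Y i ω| ≤ B) {K τ δ : ℝ} (hK : 0 < K)
    (hmgf : ∀ i t, |t| ≤ τ → mgf (Y i) μ t ≤ Real.exp (K * t ^ 2)) (hδ : 0 ≤ δ)
    (hδτ : δ / (2 * K) ≤ τ) :
    μ.real {ω | N * δ ≤ |∑ i, Y i ω|} ≤ 2 * Real.exp (-(N * δ ^ 2 / (4 * K))) := by
  have hS : AEMeasurable (∑ i, Y i) μ := Finset.aemeasurable_sum _ fun i _ => hm i
  have hint : ∀ t : ℝ, Integrable (fun ω => Real.exp (t * (∑ i, Y i) ω)) μ := fun t => by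
    refine Integrable.of_bound (C := Real.exp (|t| * (N * B)))
      (Real.measurable_exp.comp_aemeasurable (hS.const_mul t)).aestronglyMeasurable
      (ae_of_all _ fun ω => ?_)
    rw [Real.norm_eq_abs, Real.abs_exp, Real.exp_le_exp]
    refine (le_abs_self _).trans ?_
    rw [abs_mul, Finset.sum_apply]
    refine mul_le_mul_of_nonneg_left ?_ (abs_nonneg t)
    refine (Finset.abs_sum_le_sum_abs _ _).trans ((Finset.sum_le_sum fun i _ => hB i ω).trans ?_)
    simp
  have hsum : ∀ t : ℝ, |t| ≤ τ → mgf (∑ i, Y i) μ t ≤ Real.exp (N * (K * t ^ 2)) := fun t ht => by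
    rw [hind.mgf_sum₀ hm, Real.exp_nat_mul]
    calc ∏ i, mgf (Y i) μ t ≤ ∏ _i : Fin N, Real.exp (K * t ^ 2) :=
          Finset.prod_le_prod (fun i _ => mgf_nonneg) fun i _ => hmgf i t ht
      _ = _ := by simp
  have ht0 : 0 ≤ δ / (2 * K) := by positivity
  have hexp : Real.exp (-(δ / (2 * K)) * (N * δ)) * Real.exp (N * (K * (δ / (2 * K)) ^ 2))
      = Real.exp (-(N * δ ^ 2 / (4 * K))) := by
    rw [← Real.exp_add]
    congr 1
    field_simp
    ring
  have hup : μ.real {ω | N * δ ≤ (∑ i, Y i) ω} ≤ Real.exp (-(N * δ ^ 2 / (4 * K))) := by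
    refine (measure_ge_le_exp_mul_mgf _ ht0 (hint _)).trans (le_trans ?_ hexp.le)
    exact mul_le_mul_of_nonneg_left (hsum _ (by rwa [abs_of_nonneg ht0])) (Real.exp_pos _).le
  have hlow : μ.real {ω | (∑ i, Y i) ω ≤ -(N * δ)} ≤ Real.exp (-(N * δ ^ 2 / (4 * K))) := by
    refine (measure_le_le_exp_mul_mgf _ (neg_nonpos.2 ht0) (hint _)).trans (le_trans ?_ hexp.le)
    refine mul_le_mul (le_of_eq ?_) ((hsum _ (by rwa [abs_neg, abs_of_nonneg ht0])).trans_eq ?_)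
      mgf_nonneg (Real.exp_pos _).le
    · ring_nf
    · ring_nf
  have hsub : {ω | N * δ ≤ |∑ i, Y i ω|}
      ⊆ {ω | N * δ ≤ (∑ i, Y i) ω} ∪ {ω | (∑ i, Y i) ω ≤ -(N * δ)} := fun ω hω => by
    simp only [Set.mem_union, Set.mem_ofPred_eq, Finset.sum_apply] at hω ⊢
    rcases le_abs.1 hω with h | h
    · exact Or.inl h
    · exact Or.inr (by linarith)
  calc _ ≤ _ := measureReal_mono hsub
    _ ≤ _ := measureReal_union_le _ _
    _ ≤ _ := by linarith

end Chernoff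

/-! ### Moments under Haar measure. -/

namespace RandomizingChannel

variable {d : ℕ}

instance instIsHaarMeasureHaarUnitary (d : ℕ) : (haarUnitary d).IsHaarMeasure := by
  unfold haarUnitary; infer_instance

/-- Both vectors, once normalized, extend to orthonormal bases, and the change of basis is unitary.
-/
theorem exists_toOp_eq {x y : EuclideanSpace ℂ (Fin d)} (h : ‖x‖ = ‖y‖) :
    ∃ W : UGroup d, toOp W x = y := by
  rcases eq_or_ne x 0 with rfl | hx
  · exact ⟨1, by rw [map_zero, norm_eq_zero.1 (h.symm.trans norm_zero)]⟩
  have hn : ‖x‖ ≠ 0 := norm_ne_zero_iff.2 hx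
  have hd : Nonempty (Fin d) := by
    by_contra hempty
    rw [not_nonempty_iff] at hempty
    exact hx (Subsingleton.elim _ _)
  obtain ⟨j⟩ := hd
  have hbasis : ∀ z : EuclideanSpace ℂ (Fin d), ‖z‖ = ‖x‖ →
      ∃ b : OrthonormalBasis (Fin d) ℂ (EuclideanSpace ℂ (Fin d)), (‖x‖ : ℂ) • b j = z := by
    intro z hz
    have horth : Orthonormal ℂ (Set.domRestrict {j} fun _ : Fin d => ((‖x‖⁻¹ : ℝ) : ℂ) • z) :=
      ⟨fun i => by simp [Set.domRestrict_apply, norm_smul, hz, hn], fun i i' hii => (hii (Subsingleton.elim _ _)).elim⟩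
    obtain ⟨b, hb⟩ := horth.exists_orthonormalBasis_extension_of_card_eq (by simp)
    refine ⟨b, ?_⟩
    rw [hb j rfl, smul_smul, ← Complex.ofReal_mul, mul_inv_cancel₀ hn, Complex.ofReal_one, one_smul]
  obtain ⟨b, hb⟩ := hbasis x rfl
  obtain ⟨b', hb'⟩ := hbasis y h.symm
  let L := Unitary.linearIsometryEquiv.symm (b.equiv b' (Equiv.refl _))
  let Φ := Matrix.toEuclideanCLM (n := Fin d) (𝕜 := ℂ)
  refine ⟨⟨Φ.symm L, ?_⟩, ?_⟩
  · rw [Matrix.mem_unitaryGroup_iff]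
    refine (EquivLike.injective Φ) ?_
    rw [map_mul, map_star, map_one, Φ.apply_symm_apply]
    exact Unitary.mul_star_self_of_mem L.2
  · have hL : Φ (Φ.symm L) = L := Φ.apply_symm_apply _
    change Φ (Φ.symm L) x = y
    rw [hL, ← hb, ← hb', map_smul]
    congr 1
    change b.equiv b' (Equiv.refl _) (b j) = b' j
    simp

theorem continuous_toOp_apply (x : EuclideanSpace ℂ (Fin d)) :
    Continuous fun U : UGroup d => toOp U x := by
  have h : Continuous fun U : UGroup d => U.val.mulVec x.ofLp :=
    continuous_subtype_val.matrix_mulVec continuous_const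
  exact (PiLp.continuous_toLp 2 _).comp h

theorem integrable_haarUnitary {f : UGroup d → ℝ} (hf : Continuous f) :
    Integrable f (haarUnitary d) :=
  hf.integrable_of_hasCompactSupport (HasCompactSupport.of_compactSpace f)

/-- The distribution of `|⟨y, U x⟩|` for Haar-distributed `U` depends only on the norm of `y`. -/
theorem integral_norm_inner_toOp_congr (F : ℝ → ℝ) (x : EuclideanSpace ℂ (Fin d))
    {y z : EuclideanSpace ℂ (Fin d)} (h : ‖y‖ = ‖z‖) :
    ∫ U, F ‖inner ℂ y (toOp U x)‖ ∂haarUnitary d = ∫ U, F ‖inner ℂ z (toOp U x)‖ ∂haarUnitary d := by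
  obtain ⟨W, rfl⟩ := exists_toOp_eq h
  rw [← integral_mul_left_eq_self (fun U => F ‖inner ℂ (toOp W y) (toOp U x)‖) W]
  simp only [toOp_mul, inner_toOp_toOp]

/-- All basis vectors have the same second moment as y, and by Parseval these d moments sum to ‖U
x‖² = 1. -/
theorem integral_mul_norm_inner_toOp_sq {x y : EuclideanSpace ℂ (Fin d)}
    (hx : ‖x‖ = 1) (hy : ‖y‖ = 1) :
    ∫ U, d * ‖inner ℂ y (toOp U x)‖ ^ 2 ∂haarUnitary d = 1 := by
  let b := EuclideanSpace.basisFun (Fin d) ℂ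
  have h1 : ∀ j, ∫ U, ‖inner ℂ (b j) (toOp U x)‖ ^ 2 ∂haarUnitary d
      = ∫ U, ‖inner ℂ y (toOp U x)‖ ^ 2 ∂haarUnitary d := fun j =>
    integral_norm_inner_toOp_congr (fun r => r ^ 2) x (by rw [b.norm_eq_one, hy])
  have h2 : ∫ U, ∑ j, ‖inner ℂ (b j) (toOp U x)‖ ^ 2 ∂haarUnitary d = 1 := by
    simp_rw [b.sum_sq_norm_inner_right, norm_toOp, hx]
    simp
  rw [integral_finsetSum _ fun j _ => integrable_haarUnitary ?_] at h2
  · simp_rw [h1] at h2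
    rw [integral_const_mul]
    simpa using h2
  · exact ((continuous_const.inner (continuous_toOp_apply x)).norm.pow 2)

/-- Every sign vector has norm √d, so it may replace √d y without changing the integral. Averaging
over all signs before integrating over U gives √2 ≤ 2. -/
theorem integral_exp_norm_inner_toOp_sq_le {x y : EuclideanSpace ℂ (Fin d)}
    (hx : ‖x‖ = 1) (hy : ‖y‖ = 1) :
    ∫ U, Real.exp (d * ‖inner ℂ y (toOp U x)‖ ^ 2 / 8) ∂haarUnitary d ≤ 2 := by
  let s : (Fin d → Bool) → EuclideanSpace ℂ (Fin d) := fun g =>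
    WithLp.toLp 2 fun j => (boolSign (g j) : ℂ)
  have hs : ∀ g, ‖((√d : ℝ) : ℂ) • y‖ = ‖s g‖ := fun g => by
    have hsign : ∀ b, |boolSign b| = 1 := fun b => by cases b <;> simp [boolSign]
    rw [norm_smul, hy, mul_one, Complex.norm_real, Real.norm_of_nonneg (Real.sqrt_nonneg _),
      EuclideanSpace.norm_eq]
    simp [s, hsign]
  have hint : ∀ g, Integrable (fun U => Real.exp (‖inner ℂ (s g) (toOp U x)‖ ^ 2 / 8))
      (haarUnitary d) := fun g => integrable_haarUnitary <| Real.continuous_exp.comp <|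
        ((continuous_const.inner (continuous_toOp_apply x)).norm.pow 2).div_const 8
  have h1 : ∀ g, ∫ U, Real.exp (d * ‖inner ℂ y (toOp U x)‖ ^ 2 / 8) ∂haarUnitary d
      = ∫ U, Real.exp (‖inner ℂ (s g) (toOp U x)‖ ^ 2 / 8) ∂haarUnitary d := fun g => by
    rw [← integral_norm_inner_toOp_congr (fun r => Real.exp (r ^ 2 / 8)) x (hs g)]
    simp [mul_pow, abs_of_nonneg]
  have h2 : ∑ g, ∫ U, Real.exp (‖inner ℂ (s g) (toOp U x)‖ ^ 2 / 8) ∂haarUnitary d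
      ≤ 2 ^ d * √2 := by
    rw [← integral_finsetSum _ fun g _ => hint g]
    calc _ ≤ ∫ _U, 2 ^ d * √2 ∂haarUnitary d := by
          refine integral_mono (integrable_finsetSum _ fun g _ => hint g) (integrable_const _)
            fun U => ?_
          have h := sum_exp_norm_sq_signs_le (fun j => toOp U x j)
            (by rw [← EuclideanSpace.norm_sq_eq, norm_toOp, hx, one_pow])
          rw [Fintype.card_fin] at h
          refine le_trans (le_of_eq ?_) h
          refine Finset.sum_congr rfl fun g _ => ?_
          simp [s, PiLp.inner_apply, mul_comm]
      _ = _ := by simp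
  simp_rw [← h1] at h2
  simp only [Finset.sum_const, Finset.card_univ, Fintype.card_pi, Fintype.card_bool,
    Finset.prod_const, Fintype.card_fin, nsmul_eq_mul, Nat.cast_pow, Nat.cast_ofNat] at h2
  have h3 := le_of_mul_le_mul_left h2 (by positivity)
  exact h3.trans (by rw [Real.sqrt_le_left] <;> norm_num)

/-! ### Tail bounds and the union over the net. -/

section Tail

variable {N : ℕ} {Ω : Type*} [MeasurableSpace Ω] {P : Measure Ω} [IsProbabilityMeasure P]
  {U : Fin N → Ω → UGroup d}

theorem measureReal_lt_abs_deviation_le (hd : 0 < d) (hN : 0 < N)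
    (hU : ∀ i, HasLaw (U i) (haarUnitary d) P) (hind : iIndepFun U P) {δ : ℝ} (hδ : 0 ≤ δ)
    (hδ1 : δ ≤ 1) {x y : EuclideanSpace ℂ (Fin d)} (hx : ‖x‖ = 1) (hy : ‖y‖ = 1) :
    P.real {ω | δ / d < |deviation (fun i => U i ω) x y|}
      ≤ 2 * Real.exp (-(N * δ ^ 2 / 8192)) := by
  let X : UGroup d → ℝ := fun V => d * ‖inner ℂ y (toOp V x)‖ ^ 2
  have hXc : Continuous X :=
    continuous_const.mul ((continuous_const.inner (continuous_toOp_apply x)).norm.pow 2)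
  have hX0 : ∀ V, 0 ≤ X V := fun V => by positivity
  have hXd : ∀ V, X V ≤ d := fun V => by
    have h := norm_inner_le_norm (𝕜 := ℂ) y (toOp V x)
    rw [hy, norm_toOp, hx, one_mul] at h
    exact mul_le_of_le_one_right (Nat.cast_nonneg d) (pow_le_one₀ (norm_nonneg _) h)
  have hXm : Measurable fun V => X V - 1 := (hXc.sub continuous_const).measurable
  have hmgf : ∀ (i : Fin N) (t : ℝ), |t| ≤ 1 / 16 →
      mgf (fun ω => X (U i ω) - 1) P t ≤ Real.exp (2048 * t ^ 2) := fun i t ht => by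
    refine le_trans (le_of_eq ?_) (mgf_sub_one_le hX0 (integrable_haarUnitary hXc)
      (integrable_haarUnitary (Real.continuous_exp.comp (hXc.div_const 8)))
      (integral_mul_norm_inner_toOp_sq hx hy) (integral_exp_norm_inner_toOp_sq_le hx hy) ht)
    exact (hU i).integral_comp (f := fun V => Real.exp (t * (X V - 1)))
      (Real.measurable_exp.comp (hXm.const_mul t)).aestronglyMeasurable
  have htail := measureReal_le_abs_sum_le (Y := fun i ω => X (U i ω) - 1)
    (hind.comp (fun _ V => X V - 1) fun _ => hXm)
    (fun i => hXm.comp_aemeasurable (hU i).aemeasurable) (B := d + 1)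
    (fun i ω => abs_le.2 ⟨by linarith [hX0 (U i ω), (Nat.cast_nonneg d : (0 : ℝ) ≤ d)],
      by linarith [hXd (U i ω)]⟩)
    -- With K = 2048 the Chernoff parameter δ/4096 stays below 1/16 as δ ≤ 1, and 4K = 8192.
    (by norm_num) hmgf hδ (by linarith)
  norm_num at htail
  refine le_trans (measureReal_mono fun ω hω => ?_) htail
  have hd' : (0 : ℝ) < d := Nat.cast_pos.2 hd
  have hN' : (0 : ℝ) < N := Nat.cast_pos.2 hN
  have hdev : ∑ i, (X (U i ω) - 1) = N * d * deviation (fun i => U i ω) x y := by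
    simp only [X, deviation, hx, hy, Finset.sum_sub_distrib, ← Finset.mul_sum]
    simp
    field_simp
  simp only [Set.mem_ofPred_eq] at hω ⊢
  have hsum : ∑ i, X (U i ω) - N = N * d * deviation (fun i => U i ω) x y := by
    simpa using hdev
  rw [div_lt_iff₀ hd'] at hω
  rw [hsum, abs_mul, abs_of_pos (mul_pos hN' hd')]
  nlinarith

theorem measureReal_not_isRandomizing_le (hd : 0 < d) (hN : 0 < N)
    (hU : ∀ i, HasLaw (U i) (haarUnitary d) P) (hind : iIndepFun U P) {ε : ℝ} (hε : 0 < ε)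
    (hε1 : ε < 1) :
    P.real {ω | ¬ IsRandomizing ε (unitaryMixture fun i => U i ω)}
      ≤ 17 ^ (4 * d) * (2 * Real.exp (-(N * ε ^ 2 / 32768))) := by
  obtain ⟨s, hs1, hsnet, hscard⟩ :=
    exists_net_sphere (EuclideanSpace ℂ (Fin d)) (δ := 1 / 8) (by norm_num)
  -- Here 17 = 1 + 2/(1/8), and ℂ^d has real dimension 2d.
  have hcard : (s.card : ℝ) ≤ 17 ^ (2 * d) := by
    have h : Module.finrank ℝ (EuclideanSpace ℂ (Fin d)) = 2 * d := by
      rw [finrank_real_of_complex, finrank_euclideanSpace_fin]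
    rw [h] at hscard
    norm_num at hscard ⊢
    exact hscard
  have hsub : {ω | ¬ IsRandomizing ε (unitaryMixture fun i => U i ω)}
      ⊆ ⋃ p ∈ s ×ˢ s, {ω | ε / 2 / d < |deviation (fun i => U i ω) p.1 p.2|} := fun ω hω => by
    by_contra hcon
    simp only [Set.mem_iUnion, Set.mem_ofPred_eq, exists_prop, not_exists, not_and, not_lt] at hcon
    refine hω (isRandomizing_of_abs_deviation_le hN hε.le fun x y hx hy => ?_)
    have h := abs_le_of_abs_le_on_net (continuous_deviation fun i => U i ω)
      (exists_isSymmetric_deviation_left _) (exists_isSymmetric_deviation _) hs1 hsnet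
      (fun x hx y hy => hcon (x, y) (Finset.mem_product.2 ⟨hx, hy⟩)) hx hy
    refine h.trans (le_of_eq ?_)
    ring
  calc _ ≤ P.real (⋃ p ∈ s ×ˢ s, {ω | ε / 2 / d < |deviation (fun i => U i ω) p.1 p.2|}) :=
        measureReal_mono hsub (measure_ne_top P _)
    _ ≤ ∑ p ∈ s ×ˢ s, P.real {ω | ε / 2 / d < |deviation (fun i => U i ω) p.1 p.2|} :=
        measureReal_biUnion_finset_le _ _
    _ ≤ ∑ _p ∈ s ×ˢ s, 2 * Real.exp (-(N * ε ^ 2 / 32768)) :=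
        Finset.sum_le_sum fun p hp => by
          obtain ⟨h1, h2⟩ := Finset.mem_product.1 hp
          refine (measureReal_lt_abs_deviation_le hd hN hU hind (by positivity) (by linarith)
            (hs1 _ h1) (hs1 _ h2)).trans (le_of_eq ?_)
          congr 3
          ring
    _ = (s.card * s.card : ℝ) * (2 * Real.exp (-(N * ε ^ 2 / 32768))) := by
        rw [Finset.sum_const, Finset.card_product, nsmul_eq_mul, Nat.cast_mul]
    _ ≤ _ := by
        refine mul_le_mul_of_nonneg_right ?_ (by positivity)
        calc (s.card * s.card : ℝ) ≤ 17 ^ (2 * d) * 17 ^ (2 * d) := by gcongr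
          _ = _ := by rw [← pow_add]; congr 1; ring

end Tail

end RandomizingChannel

/-! ### Choice of constants. -/

theorem mainTheorem1 :
    ∃ C c : ℝ, 0 < C ∧ 0 < c ∧
      ∀ (d N : ℕ) (ε : ℝ), 0 < d → 0 < ε → ε < 1 →
        C * d / ε ^ 2 * max 1 (Real.log (1 / ε)) ≤ N →
        ∀ {Ω : Type*} [MeasurableSpace Ω] (P : Measure Ω) [IsProbabilityMeasure P]
          (U : Fin N → Ω → RandomizingChannel.UGroup d),
          (∀ i, HasLaw (U i) (RandomizingChannel.haarUnitary d) P) →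
          iIndepFun U P →
          0 < P {ω | RandomizingChannel.IsRandomizing ε
                (RandomizingChannel.unitaryMixture fun i => U i ω)} ∧
            P {ω | ¬ RandomizingChannel.IsRandomizing ε
                (RandomizingChannel.unitaryMixture fun i => U i ω)} ≤
              ENNReal.ofReal (Real.exp (-(c * ε ^ 2 * N))) := by
  -- The tail exponent Nε²/32768 is split in half: one half absorbs the net count exp(13d), the
  -- other is the final bound.
  refine ⟨13 * 65536, 1 / 65536, by norm_num, by norm_num, ?_⟩
  intro d N ε hd hε hε1 hN Ω _ P _ U hU hind
  have hd1 : (1 : ℝ) ≤ d := Nat.one_le_cast.2 hd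
  have hNd : 13 * 65536 * d ≤ N * ε ^ 2 := by
    rw [← div_le_iff₀ (by positivity)]
    exact (le_mul_of_one_le_right (by positivity) (le_max_left _ _)).trans hN
  have hNpos : 0 < N := by
    have h : (0 : ℝ) < N * ε ^ 2 := lt_of_lt_of_le (by positivity) hNd
    exact Nat.cast_pos.1 (pos_of_mul_pos_left h (by positivity))
  have hcount : (17 : ℝ) ^ (4 * d) * 2 ≤ Real.exp (13 * d) := by
    have he : (17 : ℝ) ^ 4 * 2 ≤ Real.exp 13 := by
      have h := Real.exp_one_gt_d9
      calc (17 : ℝ) ^ 4 * 2 ≤ 2.7 ^ 13 := by norm_num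
        _ ≤ Real.exp 1 ^ 13 := pow_le_pow_left₀ (by norm_num) (by linarith) _
        _ = Real.exp 13 := by rw [← Real.exp_nat_mul]; norm_num
    calc (17 : ℝ) ^ (4 * d) * 2 ≤ (17 ^ 4) ^ d * 2 ^ d := by
          rw [pow_mul]
          gcongr
          exact le_self_pow₀ (by norm_num) hd.ne'
      _ = (17 ^ 4 * 2) ^ d := (mul_pow _ _ _).symm
      _ ≤ Real.exp 13 ^ d := pow_le_pow_left₀ (by norm_num) he _
      _ = Real.exp (13 * d) := by rw [← Real.exp_nat_mul, mul_comm]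
  have hbound : P.real {ω | ¬ RandomizingChannel.IsRandomizing ε
      (RandomizingChannel.unitaryMixture fun i => U i ω)}
      ≤ Real.exp (-(1 / 65536 * ε ^ 2 * N)) := by
    refine (RandomizingChannel.measureReal_not_isRandomizing_le hd hNpos hU hind hε hε1).trans ?_
    rw [← mul_assoc]
    refine (mul_le_mul_of_nonneg_right hcount (Real.exp_pos _).le).trans ?_
    rw [← Real.exp_add, Real.exp_le_exp]
    linarith
  have hbad : P {ω | ¬ RandomizingChannel.IsRandomizing ε
      (RandomizingChannel.unitaryMixture fun i => U i ω)}
      ≤ ENNReal.ofReal (Real.exp (-(1 / 65536 * ε ^ 2 * N))) := by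
    rw [← ofReal_measureReal]
    exact ENNReal.ofReal_le_ofReal hbound
  refine ⟨pos_iff_ne_zero.2 fun h0 => ?_, hbad⟩
  have hlt : ENNReal.ofReal (Real.exp (-(1 / 65536 * ε ^ 2 * N))) < 1 := by
    rw [ENNReal.ofReal_lt_one, Real.exp_lt_one_iff]
    have : (0 : ℝ) < N := Nat.cast_pos.2 hNpos
    have : 0 < 1 / 65536 * ε ^ 2 * N := by positivity
    linarith
  -- Subadditivity holds for arbitrary sets, so the event need not be shown measurable.
  have hcover := measure_union_le (μ := P)
    {ω | RandomizingChannel.IsRandomizing ε (RandomizingChannel.unitaryMixture fun i => U i ω)}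
    {ω | ¬ RandomizingChannel.IsRandomizing ε (RandomizingChannel.unitaryMixture fun i => U i ω)}
  rw [h0, zero_add] at hcover
  have huniv : {ω | RandomizingChannel.IsRandomizing ε
      (RandomizingChannel.unitaryMixture fun i => U i ω)}
      ∪ {ω | ¬ RandomizingChannel.IsRandomizing ε
        (RandomizingChannel.unitaryMixture fun i => U i ω)} = Set.univ := by
    ext ω; simp [em]
  rw [huniv, measure_univ] at hcover
  exact absurd (hcover.trans hbad) (not_le.2 hlt)
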